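/- Let $A$ be an additively written torsion-free abelian group, let $R$ be a commutative ring with unity, and let $L=\bigoplus_{a\in A}L_a$ be an $A$-graded Lie algebra over $R$ (the $L_a$ are $R$-submodules and $[L_a,L_b]\subseteq L_{a+b}$ for all $a,b\in A$). Let $k,c\ge 0$ be integers and assume that $L_0$ is ad-nilpotent of index at most $k$, that is, $[L,\underbrace{L_0,\ldots,L_0}_{k}]=0$ (left-normed commutators). Let $H$ be a finite subgroup of $\operatorname{Aut} L$ consisting of double automorphisms: each $h\in H$ comes with an automorphism $a\mapsto a^h$ of the group $A$ such that $L_a^h=L_{a^h}$ for all $a\in A$. Write $C_A(h)=\{a\in A : a^h=a\}$ and $C_L(H)=\{l\in L : l^h=l \text{ for all } h\in H\}$. Assume that $C_A(h)=0$ for every nontrivial $h\in H$ and that $C_L(H)$ is nilpotent of class at most $c$. Then $L$ is nilpotent, and its class is at most $f(|H|,k,c)$, where $f:\mathbb{N}^3\to\mathbb{N}$ is a function that depends on none of $A$, $R$, $L$, $H$. -/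

import Mathlib

/-- The group `Aut L` of all automorphisms of a Lie algebra `L` over `R`; the product is composition
(its unit is the identity, as already fixed in Mathlib). -/
instance LieEquiv.instGroupAut {R L : Type*} [CommRing R] [LieRing L] [LieAlgebra R L] :
    Group (L ≃ₗ⁅R⁆ L) where
  mul f g := g.trans f
  one := 1
  inv f := f.symm
  mul_assoc _ _ _ := rfl
  one_mul _ := rfl
  mul_one _ := rfl
  inv_mul_cancel f := LieEquiv.ext fun x => f.symm_apply_apply x

/-- The subspace `K` of the Lie algebra `L` is ad-nilpotent of index (at most) `n`:
`[L, K, …, K] = 0` with `n` copies of `K`, where commutators are left-normed,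
`[l, x₁, …, xₙ] = [[…[[l, x₁], x₂], …], xₙ]`. -/
def IsAdNilpotent {R L : Type*} [CommRing R] [LieRing L] [LieAlgebra R L]
    (K : Submodule R L) (n : ℕ) : Prop :=
  ∀ (l : L) (xs : List L), xs.length = n → (∀ x ∈ xs, x ∈ K) →
    xs.foldl (fun u x => ⁅u, x⁆) l = 0

/-- The Lie algebra `L` is nilpotent of class at most `n`. Mathlib's lower central series starts
with term number `0` equal to `L`, so term number `n` is spanned by the commutators of weight
`n + 1`. -/
def IsNilpotentOfClass (R L : Type*) [CommRing R] [LieRing L] [LieAlgebra R L] (n : ℕ) : Prop :=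
  LieModule.lowerCentralSeries R L L n = ⊥

/-- The automorphism `φ` of the `A`-graded Lie algebra `L = ⨁ a, ℒ a` is a double automorphism
that acts on the group `A` as the automorphism `σ`: it maps the component `ℒ a` onto `ℒ (σ a)`
for every `a`. (If all components are nonzero then `φ` determines `σ`; on degrees of zero components
`φ` alone says nothing, therefore `σ` is kept explicit.) -/
def IsDoubleAutomorphism {A R L : Type*} [AddCommGroup A] [CommRing R] [LieRing L] [LieAlgebra R L]
    (ℒ : A → Submodule R L) (φ : L ≃ₗ⁅R⁆ L) (σ : A ≃+ A) : Prop :=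
  ∀ a : A, (ℒ a).map (φ.toLinearEquiv : L →ₗ[R] L) = ℒ (σ a)

/-- The subgroup `C_A(h) = {a | a ^ h = a}`, where `σ` is the automorphism of `A` given by `h`. -/
def fixedDegrees {A : Type*} [AddCommGroup A] (σ : A ≃+ A) : AddSubgroup A where
  carrier := {a | σ a = a}
  zero_mem' := map_zero σ
  add_mem' {a b} (ha : σ a = a) (hb : σ b = b) := show σ (a + b) = a + b by rw [map_add, ha, hb]
  neg_mem' {a} (ha : σ a = a) := show σ (-a) = -a by rw [map_neg, ha]

/-- The subalgebra `C_L(H)` of the fixed points of a group `H` of automorphisms of `L`. -/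
def fixedSubalgebra {R L : Type*} [CommRing R] [LieRing L] [LieAlgebra R L]
    (H : Subgroup (L ≃ₗ⁅R⁆ L)) : LieSubalgebra R L where
  carrier := {x | ∀ h ∈ H, h x = x}
  zero_mem' := fun h _ => map_zero h
  add_mem' {x y} hx hy := fun h hh => by rw [map_add, hx h hh, hy h hh]
  smul_mem' r x hx := fun h hh => by rw [map_smul, hx h hh]
  lie_mem' {x y} hx hy := fun h hh => by rw [LieEquiv.map_lie, hx h hh, hy h hh]

/-! For homogeneous `x` the orbit sum of `x` is fixed by `H`, so a commutator of `c + 1` orbit sums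
vanishes. Its expansion contains the commutator of the chosen elements themselves, which is
therefore zero unless another term has the same degree (`IsFixedApprox.eq_zero`). Since `A` is
torsion-free, it can be ordered, and this is used in two ways.

If all letters have the same degree `e ≠ 0`, twist the order so that `e` is greatest in its orbit.
Collisions then come only from shifts of the initial degree, and a pigeonhole argument finds a
starting point without any. Hence long words in one component act as zero
(`wordAct_eq_zero_of_degree_ne_zero`); for degree `0` this is the ad-nilpotency.

A collision-free commutator `u` extends to a longer one by letters of all but boundedly many degrees
(`exists_extension_degrees`). By downward induction on weight, the extensions lie in a bounded term
`Z` of the upper central series, so only boundedly many components act nontrivially on `u` modulo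
`Z`. Reordering letters modulo shorter words, `u` generates a module supported in boundedly many
degrees (`exists_support`). A long word thus keeps returning to one degree, and each loop either has
a positive letter, which moved forward leads higher, or adds letters of degree `0`. Neither can go
on for long (`wordAct_loops_eq_zero`), so `u` lies in a bounded later term
(`IsFixedApprox.mem_ucs`). -/

/-! ### Words in homogeneous letters and finite support -/

section LetterWords

variable {A R L V : Type*} [CommRing R] [LieRing L] [LieAlgebra R L]
  [AddCommGroup V] [LieRingModule L V]

/-- The degree of a word in homogeneous elements. -/
def wordDegree [AddCommGroup A] {ℒ : A → Submodule R L} (w : List (Σ a, ℒ a)) : A :=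
  (w.map Sigma.fst).sum

/-- The action of a word in homogeneous elements on a module, first letter first. -/
def wordAct {ℒ : A → Submodule R L} (v : V) (w : List (Σ a, ℒ a)) : V :=
  w.foldl (fun v x => ⁅(x.2 : L), v⁆) v

variable {ℒ : A → Submodule R L}

@[simp] theorem wordAct_nil (v : V) : wordAct v ([] : List (Σ a, ℒ a)) = v := rfl

@[simp] theorem wordAct_cons (v : V) (x : Σ a, ℒ a) (w : List (Σ a, ℒ a)) :
    wordAct v (x :: w) = wordAct ⁅(x.2 : L), v⁆ w := rfl

theorem wordAct_append (v : V) (w w' : List (Σ a, ℒ a)) :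
    wordAct v (w ++ w') = wordAct (wordAct v w) w' := List.foldl_append

@[simp] theorem wordAct_zero (w : List (Σ a, ℒ a)) : wordAct (0 : V) w = 0 := by
  induction w with
  | nil => rfl
  | cons x w ih => simpa using ih

theorem wordAct_add (v v' : V) (w : List (Σ a, ℒ a)) :
    wordAct (v + v') w = wordAct v w + wordAct v' w := by
  induction w generalizing v v' with
  | nil => rfl
  | cons x w ih => simp [ih]

theorem wordAct_append_eq_zero {v : V} {w : List (Σ a, ℒ a)} (h : wordAct v w = 0)
    (w' : List (Σ a, ℒ a)) : wordAct v (w ++ w') = 0 := by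
  rw [wordAct_append, h, wordAct_zero]

variable [AddCommGroup A]

@[simp] theorem wordDegree_nil : wordDegree ([] : List (Σ a, ℒ a)) = 0 := rfl

@[simp] theorem wordDegree_cons (x : Σ a, ℒ a) (w : List (Σ a, ℒ a)) :
    wordDegree (x :: w) = x.1 + wordDegree w := by simp [wordDegree]

@[simp] theorem wordDegree_append (w w' : List (Σ a, ℒ a)) :
    wordDegree (w ++ w') = wordDegree w + wordDegree w' := by simp [wordDegree]

theorem wordDegree_perm {w w' : List (Σ a, ℒ a)} (h : w.Perm w') :
    wordDegree w = wordDegree w' := (h.map Sigma.fst).sum_eq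

/-- Permuting the letters of a word does not change its action if all shorter nonempty words of
the same degree act as zero. -/
theorem wordAct_perm (hb : ∀ {a b : A} {x y : L}, x ∈ ℒ a → y ∈ ℒ b → ⁅x, y⁆ ∈ ℒ (a + b))
    {w w' : List (Σ a, ℒ a)} (h : w.Perm w') (r : List (Σ a, ℒ a)) :
    ∀ v : V, (∀ z : List (Σ a, ℒ a), z ≠ [] → z.length < w.length →
        wordDegree z = wordDegree w → wordAct v (z ++ r) = 0) →
      wordAct v (w ++ r) = wordAct v (w' ++ r) := by
  induction h with
  | nil => intro v _; rfl
  | @cons x w w' _ ih =>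
    intro v hz
    simp only [List.cons_append, wordAct_cons]
    refine ih _ fun z _ hl hd => ?_
    simpa using hz (x :: z) (by simp) (by simpa using hl) (by simp [hd])
  | swap x y l =>
    intro v hz
    -- Swapping two letters costs the word in which their bracket replaces them: one letter shorter,
    -- same degree.
    have key := hz (⟨x.1 + y.1, ⟨⁅(x.2 : L), (y.2 : L)⁆, hb x.2.2 y.2.2⟩⟩ :: l) (by simp)
      (by simp) (by simp only [wordDegree_cons]; abel)
    simp only [List.cons_append, wordAct_cons] at key ⊢
    rw [leibniz_lie, wordAct_add, key, zero_add]
  | @trans w₁ w₂ w₃ h₁ h₂ ih₁ ih₂ =>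
    intro v hz
    rw [ih₁ v hz]
    exact ih₂ v fun z hne hl hd =>
      hz z hne (by rwa [h₁.length_eq]) (by rw [hd, wordDegree_perm h₁])

/-- If `U` is annihilated by all components with degrees outside a finite set `D`, and long words
in any one component act as zero, then the submodule generated by `U` has finite support. -/
theorem exists_support [DecidableEq A]
    (hb : ∀ {a b : A} {x y : L}, x ∈ ℒ a → y ∈ ℒ b → ⁅x, y⁆ ∈ ℒ (a + b))
    (U : V) (D : Finset A) (M : ℕ)
    (hD : ∀ x : Σ a, ℒ a, x.1 ∉ D → ⁅(x.2 : L), U⁆ = 0)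
    (hM : ∀ (e : A) (w : List (Σ a, ℒ a)) (v : V), (∀ x ∈ w, x.1 = e) → M ≤ w.length →
      wordAct v w = 0) :
    ∃ P : Finset A, P.card ≤ M ^ D.card ∧
      ∀ w : List (Σ a, ℒ a), wordDegree w ∉ P → wordAct U w = 0 := by
  classical
  -- These are the degrees of words with letters from `D`, each degree occurring fewer than `M`
  -- times. Any other word can be reordered to vanish, shorter words of its degree being zero by
  -- induction.
  refine ⟨Finset.univ.image fun n : D → Fin M => ∑ e : D, (n e : ℕ) • (e : A), ?_, ?_⟩
  · exact Finset.card_image_le.trans (by simp)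
  intro w
  induction hn : w.length using Nat.strong_induction_on generalizing w with
  | _ n ih =>
    subst hn
    intro hw
    have hz : ∀ z : List (Σ a, ℒ a), z ≠ [] → z.length < w.length →
        wordDegree z = wordDegree w → wordAct U (z ++ []) = 0 := fun z _ hl hd => by
      rw [List.append_nil]
      exact ih _ hl z rfl (by rwa [hd])
    by_cases h1 : ∃ x ∈ w, x.1 ∉ D
    · obtain ⟨x, hx, hxD⟩ := h1
      obtain ⟨l, r, rfl⟩ := List.append_of_mem hx
      have := wordAct_perm hb (List.perm_middle (a := x) (l₁ := l) (l₂ := r)) [] U hz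
      rw [List.append_nil, List.append_nil] at this
      rw [this, wordAct_cons, hD x hxD, wordAct_zero]
    push Not at h1
    by_cases h2 : ∃ e, M ≤ (w.map Sigma.fst).count e
    · obtain ⟨e, he⟩ := h2
      have := wordAct_perm hb (List.filter_append_perm (fun x => decide (x.1 = e)) w).symm [] U hz
      rw [List.append_nil, List.append_nil] at this
      rw [this]
      refine wordAct_append_eq_zero (hM e _ U (by simp) ?_) _
      rw [← List.countP_eq_length_filter]
      rw [List.count, List.countP_map] at he
      exact he
    push Not at h2
    refine absurd ?_ hw
    rw [Finset.mem_image]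
    refine ⟨fun e => ⟨_, h2 e⟩, Finset.mem_univ _, ?_⟩
    rw [wordDegree, Finset.sum_list_count_of_subset _ D]
    · exact Finset.sum_coe_sort D fun e => (w.map Sigma.fst).count e • e
    · intro a ha
      simp only [List.mem_toFinset, List.mem_map] at ha
      obtain ⟨x, hx, rfl⟩ := ha
      exact h1 x hx

end LetterWords

/-! ### Long words on a module with finite support -/

section Visits

variable {A R L V : Type*} [CommRing R] [LieRing L] [LieAlgebra R L]
  [AddCommGroup V] [LieRingModule L V]
  [AddCommGroup A] {ℒ : A → Submodule R L}

/-- The number of nonempty prefixes `y` of the word such that `S` holds for `a + wordDegree y`. -/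
def visits (S : A → Prop) [DecidablePred S] : A → List (Σ a, ℒ a) → ℕ
  | _, [] => 0
  | a, x :: w => (if S (a + x.1) then 1 else 0) + visits S (a + x.1) w

theorem visits_append (S : A → Prop) [DecidablePred S] (a : A) (y z : List (Σ a, ℒ a)) :
    visits S a (y ++ z) = visits S a y + visits S (a + wordDegree y) z := by
  induction y generalizing a with
  | nil => simp [visits]
  | cons x y ih => simp [visits, ih, add_assoc]

theorem exists_prefix_of_visits_pos (S : A → Prop) [DecidablePred S] (a : A)
    (w : List (Σ a, ℒ a)) (h : 0 < visits S a w) :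
    ∃ y z, y ≠ [] ∧ w = y ++ z ∧ S (a + wordDegree y) ∧
      visits S (a + wordDegree y) z + 1 = visits S a w := by
  induction w generalizing a with
  | nil => simp [visits] at h
  | cons x w ih =>
    by_cases hS : S (a + x.1)
    · exact ⟨[x], w, by simp, by simp, by simpa using hS, by simp [visits, hS, add_comm]⟩
    · simp only [visits, hS, if_false, zero_add] at h
      obtain ⟨y, z, -, rfl, h1, h2⟩ := ih _ h
      exact ⟨x :: y, z, by simp, by simp, by simpa [add_assoc] using h1,
        by simpa [visits, hS, add_assoc] using h2⟩

theorem exists_loops [DecidableEq A] (p : A) (n : ℕ) (w : List (Σ a, ℒ a))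
    (h : n ≤ visits (· = p) p w) :
    ∃ (ls : List (List (Σ a, ℒ a))) (z : List (Σ a, ℒ a)), w = ls.flatten ++ z ∧ ls.length = n ∧
      ∀ l ∈ ls, l ≠ [] ∧ wordDegree l = 0 := by
  induction n generalizing w with
  | zero => exact ⟨[], w, by simp⟩
  | succ n ih =>
    obtain ⟨y, z, hy, rfl, hp, hv⟩ := exists_prefix_of_visits_pos (· = p) p w (by omega)
    rw [hp] at hv
    obtain ⟨ls, z', rfl, hl, hls⟩ := ih z (by omega)
    refine ⟨y :: ls, z', by simp, by simp [hl], ?_⟩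
    intro l hl
    rcases List.mem_cons.1 hl with rfl | hl
    · exact ⟨hy, by simpa using hp⟩
    · exact hls l hl

theorem visits_le_add (S T T' : A → Prop) [DecidablePred S] [DecidablePred T] [DecidablePred T']
    (h : ∀ a, S a → T a ∨ T' a) (a : A) (w : List (Σ a, ℒ a)) :
    visits S a w ≤ visits T a w + visits T' a w := by
  induction w generalizing a with
  | nil => simp [visits]
  | cons x w ih =>
    have h1 := ih (a + x.1)
    have h2 := h (a + x.1)
    simp only [visits]
    split_ifs <;> first | omega | tauto

theorem visits_true (a : A) (w : List (Σ a, ℒ a)) : visits (fun _ => True) a w = w.length := by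
  induction w generalizing a with
  | nil => rfl
  | cons x w ih => simp [visits, ih, add_comm]

theorem exists_pos_letter [LinearOrder A] [IsOrderedAddMonoid A] {l : List (Σ a, ℒ a)}
    (h0 : wordDegree l = 0) (hne : ¬ ∀ x ∈ l, x.1 = 0) : ∃ x ∈ l, 0 < x.1 := by
  by_contra! h
  apply hne
  clear hne
  have hle : ∀ l : List (Σ a, ℒ a), (∀ x ∈ l, x.1 ≤ 0) → wordDegree l ≤ 0 := by
    intro l
    induction l with
    | nil => simp
    | cons x l ih =>
      intro hx
      rw [wordDegree_cons]
      exact add_nonpos (hx x (by simp)) (ih fun y hy => hx y (by simp [hy]))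
  induction l with
  | nil => simp
  | cons x l ih =>
    rw [wordDegree_cons] at h0
    have h1 := h x (by simp)
    have h2 := hle l fun y hy => h y (by simp [hy])
    have h3 : x.1 = 0 := le_antisymm h1 (by rw [eq_neg_of_add_eq_zero_left h0]; simpa using h2)
    rw [h3, zero_add] at h0
    intro y hy
    rcases List.mem_cons.1 hy with rfl | hy
    · exact h3
    · exact ih h0 (fun y hy => h y (by simp [hy])) y hy

/-- Here `m` counts the visits above `p` still missing and `j` the letters still missing from the
current run `ζ` of degree `0`. Each loop at `p` lowers one of them; a visit above `p` breaks the
run, so `j` restarts at `k`, whence `m * k + j` loops suffice. -/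
theorem wordAct_loops_eq_zero [LinearOrder A] [IsOrderedAddMonoid A]
    (hb : ∀ {a b : A} {x y : L}, x ∈ ℒ a → y ∈ ℒ b → ⁅x, y⁆ ∈ ℒ (a + b))
    (U : V) (k B : ℕ) (p : A)
    (hk : ∀ (w : List (Σ a, ℒ a)) (v : V), (∀ x ∈ w, x.1 = 0) → k ≤ w.length → wordAct v w = 0)
    (hB : ∀ w : List (Σ a, ℒ a), B ≤ visits (p < ·) 0 w → wordAct U w = 0) (m j : ℕ) :
    ∀ (y ζ : List (Σ a, ℒ a)) (ls : List (List (Σ a, ℒ a))) (z : List (Σ a, ℒ a)),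
      wordDegree y = p → B ≤ visits (p < ·) 0 y + m → (∀ x ∈ ζ, x.1 = 0) → k ≤ ζ.length + j →
      m * k + j ≤ ls.length → (∀ l ∈ ls, l ≠ [] ∧ wordDegree l = 0) →
      wordAct U (y ++ (ζ ++ (ls.flatten ++ z))) = 0 := by
  induction m generalizing j with
  | zero =>
    intro y ζ ls z _ hv _ _ _ _
    exact wordAct_append_eq_zero (hB y (by omega)) _
  | succ m ihm =>
    induction j with
    | zero =>
      intro y ζ ls z _ _ hζ hl _ _
      rw [wordAct_append]
      exact wordAct_append_eq_zero (hk ζ _ hζ hl) _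
    | succ j ihj =>
      intro y ζ ls z hy hv hζ hl hls hloop
      obtain _ | ⟨l, ls⟩ := ls
      · simp at hls
      have hlen : (m + 1) * k + j ≤ ls.length := by simp at hls; omega
      have hloop' : ∀ l ∈ ls, l ≠ [] ∧ wordDegree l = 0 := fun l hl => hloop l (by simp [hl])
      obtain ⟨hne, h0⟩ := hloop l (by simp)
      have hζ0 : wordDegree ζ = 0 := by
        refine List.sum_eq_zero fun a ha => ?_
        obtain ⟨x, hx, rfl⟩ := List.mem_map.1 ha
        exact hζ x hx
      clear hloop hls
      -- Moving a positive letter to the front of the loop leaves errors with shorter loops of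
      -- degree `0`, which vanish by this induction.
      induction hn : l.length using Nat.strong_induction_on generalizing l with
      | _ n ihn =>
        subst hn
        by_cases hzero : ∀ x ∈ l, x.1 = 0
        · have hpos := List.length_pos_iff.2 hne
          have := ihj y (ζ ++ l) ls z hy hv
            (fun x hx => (List.mem_append.1 hx).elim (hζ x) (hzero x))
            (by simp; omega) hlen hloop'
          simpa using this
        · obtain ⟨x, hx, hxp⟩ := exists_pos_letter h0 hzero
          obtain ⟨s, t, rfl⟩ := List.append_of_mem hx
          have hp := wordAct_perm hb (List.perm_middle (a := x) (l₁ := s) (l₂ := t))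
            (ls.flatten ++ z) (wordAct U (y ++ ζ)) ?_
          · have hdeg : wordDegree (y ++ ζ ++ (x :: (s ++ t))) = p := by
              rw [wordDegree_append, wordDegree_append, hy, hζ0,
                ← wordDegree_perm List.perm_middle, h0]
              simp
            have := ihm k (y ++ ζ ++ (x :: (s ++ t))) [] ls z hdeg ?_ (by simp) (by simp)
              (by rw [add_mul] at hlen; omega) hloop'
            · rw [← wordAct_append, ← wordAct_append] at hp
              simp only [List.append_assoc, List.nil_append, List.flatten_cons] at hp this ⊢
              rw [hp, this]
            · rw [visits_append, visits_append]
              have : p < p + x.1 := by simpa using hxp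
              simp only [visits, wordDegree_append, hy, hζ0, add_zero, zero_add, this, if_true]
              omega
          · intro q hq hql hqd
            have := ihn _ hql q hq (by rw [hqd, h0]) rfl
            rw [← wordAct_append]
            simpa using this

/-- The bound for the number of visits to an upper set containing `n` points of the support. -/
def visitBound (k : ℕ) : ℕ → ℕ
  | 0 => 1
  | n + 1 => visitBound k n + (visitBound k n * k + k + 1)

/-- Induction on the number of support points in `S`. If `p` is the least one, each visit to `S` is
outside the support, above `p` (few, by induction) or at `p`; many visits at `p` cut the word into
loops. -/
theorem wordAct_eq_zero_of_visits [LinearOrder A] [IsOrderedAddMonoid A]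
    (hb : ∀ {a b : A} {x y : L}, x ∈ ℒ a → y ∈ ℒ b → ⁅x, y⁆ ∈ ℒ (a + b))
    (U : V) (k : ℕ) (P : Finset A)
    (hk : ∀ (w : List (Σ a, ℒ a)) (v : V), (∀ x ∈ w, x.1 = 0) → k ≤ w.length → wordAct v w = 0)
    (hP : ∀ w : List (Σ a, ℒ a), wordDegree w ∉ P → wordAct U w = 0) (n : ℕ) :
    ∀ (S : A → Prop) [DecidablePred S], (∀ a b, a ≤ b → S a → S b) → (P.filter S).card ≤ n →
      ∀ w : List (Σ a, ℒ a), visitBound k n ≤ visits S 0 w → wordAct U w = 0 := by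
  have hvisit : ∀ (S : A → Prop) [DecidablePred S], (∀ a ∈ P, ¬ S a) →
      ∀ w : List (Σ a, ℒ a), 0 < visits S 0 w → wordAct U w = 0 := by
    intro S _ hS w hw
    obtain ⟨y, z, -, rfl, h1, -⟩ := exists_prefix_of_visits_pos S 0 w hw
    rw [zero_add] at h1
    exact wordAct_append_eq_zero (hP y fun h => hS _ h h1) _
  induction n with
  | zero =>
    intro S _ _ hc w hw
    refine hvisit S (fun a ha hS => ?_) w hw
    rw [Nat.le_zero, Finset.card_eq_zero] at hc
    simpa [hc] using Finset.mem_filter.2 ⟨ha, hS⟩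
  | succ n ih =>
    intro S _ hup hc w hw
    by_cases hne : (P.filter S).Nonempty
    swap
    · refine hvisit S (fun a ha hS => hne ⟨a, Finset.mem_filter.2 ⟨ha, hS⟩⟩) w ?_
      simp only [visitBound] at hw
      omega
    set p := (P.filter S).min' hne with hpdef
    have hpmem : p ∈ P.filter S := Finset.min'_mem _ _
    have hmin : ∀ a ∈ P, S a → a = p ∨ p < a := fun a ha hS =>
      (Finset.min'_le _ a (Finset.mem_filter.2 ⟨ha, hS⟩)).eq_or_lt.imp_left Eq.symm
    have hB := ih (p < ·) (fun a b hab h => h.trans_le hab) <| by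
      have : P.filter (p < ·) ⊂ P.filter S := by
        refine ⟨fun a ha => ?_, fun h => ?_⟩
        · rw [Finset.mem_filter] at ha hpmem ⊢
          exact ⟨ha.1, hup _ _ ha.2.le hpmem.2⟩
        · simpa using (Finset.mem_filter.1 (h hpmem)).2
      have := Finset.card_lt_card this
      omega
    by_cases hout : 0 < visits (fun a => S a ∧ a ∉ P) 0 w
    · exact hvisit _ (fun a ha h => h.2 ha) w hout
    have h1 := visits_le_add S (fun a => S a ∧ a ∉ P) (fun a => a = p ∨ p < a)
      (fun a hS => by by_cases ha : a ∈ P <;> [exact Or.inr (hmin a ha hS); exact Or.inl ⟨hS, ha⟩])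
      0 w
    have h2 := visits_le_add (fun a => a = p ∨ p < a) (· = p) (p < ·) (fun a h => h) 0 w
    by_cases h3 : visitBound k n ≤ visits (p < ·) 0 w
    · exact hB w h3
    simp only [visitBound] at hw
    obtain ⟨y, z, -, rfl, h4, h5⟩ := exists_prefix_of_visits_pos (· = p) 0 w (by omega)
    rw [h4] at h5
    rw [zero_add] at h4
    obtain ⟨ls, z, rfl, hlen, hls⟩ := exists_loops p (visitBound k n * k + k) z (by omega)
    simpa using wordAct_loops_eq_zero hb U k (visitBound k n) p hk hB (visitBound k n) k y [] ls z
      h4 (by omega) (by simp) (by simp) hlen.ge hls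

/-- If `U` is annihilated by all components with degrees outside a finite set of size at most `d`,
and words of length `M` in any one component act as zero, then all words of bounded length
annihilate `U`. -/
theorem wordAct_eq_zero_of_length [LinearOrder A] [IsOrderedAddMonoid A]
    (hb : ∀ {a b : A} {x y : L}, x ∈ ℒ a → y ∈ ℒ b → ⁅x, y⁆ ∈ ℒ (a + b))
    (U : V) (D : Finset A) (d M : ℕ) (hd : D.card ≤ d) (hM0 : 0 < M)
    (hD : ∀ x : Σ a, ℒ a, x.1 ∉ D → ⁅(x.2 : L), U⁆ = 0)
    (hM : ∀ (e : A) (w : List (Σ a, ℒ a)) (v : V), (∀ x ∈ w, x.1 = e) → M ≤ w.length →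
      wordAct v w = 0)
    (w : List (Σ a, ℒ a)) (hw : visitBound M (M ^ d) ≤ w.length) : wordAct U w = 0 := by
  obtain ⟨P, hPc, hP⟩ := exists_support hb U D M hD hM
  refine wordAct_eq_zero_of_visits hb U M P (hM 0) hP (M ^ d) (fun _ => True) (by simp) ?_ w ?_
  · exact (Finset.card_filter_le _ _).trans (hPc.trans (Nat.pow_le_pow_right hM0 hd))
  · rwa [visits_true]

end Visits

/-! ### Ordering the group of degrees -/

/-- The order is lexicographic in the coordinates of a `ℚ`-basis of the divisible hull. -/
theorem exists_linearOrder_isOrderedAddMonoid (A : Type*) [AddCommGroup A] [IsAddTorsionFree A] :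
    ∃ _ : LinearOrder A, IsOrderedAddMonoid A := by
  classical
  let b := Module.Basis.ofVectorSpace ℚ (DivisibleHull A)
  let _ : LinearOrder (Module.Basis.ofVectorSpaceIndex ℚ (DivisibleHull A)) :=
    linearOrderOfSTO WellOrderingRel
  let φ : A → Lex (Module.Basis.ofVectorSpaceIndex ℚ (DivisibleHull A) →₀ ℚ) :=
    fun a => toLex (b.repr (a : DivisibleHull A))
  have hφ : Function.Injective φ :=
    toLex.injective.comp (b.repr.injective.comp DivisibleHull.coe_injective)
  have hadd : ∀ x y, φ (x + y) = φ x + φ y := fun x y => by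
    simp only [φ, DivisibleHull.coe_add, map_add, toLex_add]
  let o : LinearOrder A := LinearOrder.lift' φ hφ
  refine ⟨o, ⟨fun x y h z => ?_, fun x y h z => ?_⟩⟩
  · change φ (x + z) ≤ φ (y + z)
    rw [hadd, hadd]
    exact add_le_add_left (show φ x ≤ φ y from h) _
  · change φ (z + x) ≤ φ (z + y)
    rw [hadd, hadd]
    exact add_le_add_right (show φ x ≤ φ y from h) _

/-! ### Words, quotients and the upper central series -/

section HomogeneousWords

variable {A R L : Type*} [CommRing R] [LieRing L] [LieAlgebra R L] {ℒ : A → Submodule R L}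

theorem wordAct_eq_zero_iff_foldl (v : L) (w : List (Σ a, ℒ a)) :
    wordAct v w = 0 ↔ (w.map fun x => (x.2 : L)).foldl (fun u x => ⁅u, x⁆) v = 0 := by
  have hneg : ∀ (v : L) (w : List (Σ a, ℒ a)), wordAct (-v) w = -wordAct v w := fun v w =>
    eq_neg_of_add_eq_zero_left (by rw [← wordAct_add, neg_add_cancel, wordAct_zero])
  induction w generalizing v with
  | nil => rfl
  | cons x w ih =>
    rw [wordAct_cons, ← lie_skew, hneg, neg_eq_zero]
    exact ih _

theorem wordAct_mk (Z : LieIdeal R L) (v : L) (w : List (Σ a, ℒ a)) :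
    wordAct (LieSubmodule.Quotient.mk v : L ⧸ Z) w = LieSubmodule.Quotient.mk (wordAct v w) := by
  induction w generalizing v with
  | nil => rfl
  | cons x w ih => rw [wordAct_cons, wordAct_cons, ← ih]; rfl

theorem mem_ucs_succ_of_homogeneous (htop : ⨆ a, ℒ a = ⊤) (Z : LieIdeal R L) (n : ℕ) (u : L)
    (h : ∀ a, ∀ x ∈ ℒ a, ⁅x, u⁆ ∈ Z.ucs n) : u ∈ Z.ucs (n + 1) := by
  rw [LieSubmodule.ucs_succ, LieSubmodule.mem_normalizer]
  intro y
  have hy : y ∈ ⨆ a, ℒ a := htop ▸ Submodule.mem_top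
  induction hy using Submodule.iSup_induction' with
  | mem a x hx => exact h a x hx
  | zero => simp
  | add x y _ _ hx hy => rw [add_lie]; exact add_mem hx hy

theorem mem_ucs_of_forall_words (htop : ⨆ a, ℒ a = ⊤) (Z : LieIdeal R L) (n : ℕ) (u : L)
    (h : ∀ w : List (Σ a, ℒ a), w.length = n → wordAct u w ∈ Z) : u ∈ Z.ucs n := by
  induction n generalizing u with
  | zero => exact h [] rfl
  | succ n ih =>
    exact mem_ucs_succ_of_homogeneous htop Z n u fun a x hx =>
      ih _ fun w hw => h (⟨a, x, hx⟩ :: w) (by simp [hw])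

theorem wordAct_mem [AddCommGroup A]
    (hb : ∀ {a b : A} {x y : L}, x ∈ ℒ a → y ∈ ℒ b → ⁅x, y⁆ ∈ ℒ (a + b))
    {e s : A} {v : L} (hv : v ∈ ℒ s) (w : List (Σ a, ℒ a)) (hw : ∀ x ∈ w, x.1 = e) :
    wordAct v w ∈ ℒ (s + w.length • e) := by
  induction w generalizing s v with
  | nil => simpa using hv
  | cons x w ih =>
    have hx : x.1 = e := hw x (by simp)
    have hx2 : (x.2 : L) ∈ ℒ e := hx ▸ x.2.2
    have := ih (hb hx2 hv) fun y hy => hw y (by simp [hy])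
    rw [wordAct_cons, List.length_cons, succ_nsmul, add_comm _ e, ← add_assoc, add_comm s e]
    exact this

end HomogeneousWords

/-! ### Approximating commutators by fixed points -/

section FixedApproximation

variable {A R L : Type*} [CommRing R] [LieRing L] [LieAlgebra R L]

/-- The homogeneous element `u` of degree `s` is, up to components with degrees in `N`, a
commutator of weight `n + 1` in fixed points of `H`. -/
structure IsFixedApprox (ℒ : A → Submodule R L) (H : Subgroup (L ≃ₗ⁅R⁆ L)) (n : ℕ) (s : A)
    (N : Finset A) (u : L) : Prop where
  mem : u ∈ ℒ s
  exists_fixed : ∃ w ∈ LieModule.lowerCentralSeries R (fixedSubalgebra H) (fixedSubalgebra H) n,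
    (w : L) - u ∈ ⨆ b ∈ N, ℒ b

/-- The fixed commutator vanishes, so `u` lies both in degree `s` and in a sum of components of
other degrees. -/
theorem IsFixedApprox.eq_zero {ℒ : A → Submodule R L} {H : Subgroup (L ≃ₗ⁅R⁆ L)} {n : ℕ} {s : A}
    {N : Finset A} {u : L} (h : IsFixedApprox ℒ H n s N u) (hind : iSupIndep ℒ)
    (hc : IsNilpotentOfClass R (fixedSubalgebra H) n) (hs : s ∉ N) : u = 0 := by
  obtain ⟨hu, w, hw, hwu⟩ := h
  rw [hc, LieSubmodule.mem_bot] at hw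
  rw [hw, ZeroMemClass.coe_zero, zero_sub, neg_mem_iff] at hwu
  refine (Submodule.disjoint_def.1 (hind s)) u hu ?_
  refine (iSup₂_mono' fun b hb => ⟨b, fun h => hs (h ▸ hb), le_rfl⟩ :
    ⨆ b ∈ N, ℒ b ≤ ⨆ b, ⨆ (_ : b ≠ s), ℒ b) hwu

variable [AddCommGroup A] [DecidableEq A] {H : Subgroup (L ≃ₗ⁅R⁆ L)} [Fintype H]

/-- The set of sums of `n` elements of the orbit of `e`. -/
def orbitSums (σ : H → A ≃+ A) (e : A) : ℕ → Finset A
  | 0 => {0}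
  | n + 1 => (orbitSums σ e n ×ˢ (Finset.univ : Finset H)).image fun p => p.1 + σ p.2 e

theorem card_orbitSums_le (σ : H → A ≃+ A) (e : A) (n : ℕ) :
    (orbitSums σ e n).card ≤ Fintype.card H ^ n := by
  induction n with
  | zero => simp [orbitSums]
  | succ n ih =>
    refine Finset.card_image_le.trans ?_
    rw [Finset.card_product, pow_succ]
    exact Nat.mul_le_mul_right _ ih

variable [DecidableEq H]

/-- The degrees that have to be avoided after multiplication by a homogeneous element of
degree `a`. -/
def shiftedDegrees (σ : H → A ≃+ A) (s : A) (N : Finset A) (a : A) : Finset A :=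
  (N ×ˢ (Finset.univ : Finset H)).image (fun p => p.1 + σ p.2 a) ∪
    (Finset.univ.filter (· ≠ (1 : H))).image (fun h => s + σ h a)

theorem mem_shiftedDegrees {σ : H → A ≃+ A} {s : A} {N : Finset A} {a y : A} :
    y ∈ shiftedDegrees σ s N a ↔
      (∃ z ∈ N, ∃ h, z + σ h a = y) ∨ ∃ h, h ≠ 1 ∧ s + σ h a = y := by
  simp [shiftedDegrees]

theorem card_shiftedDegrees_le (σ : H → A ≃+ A) (s : A) (N : Finset A) (a : A) :
    (shiftedDegrees σ s N a).card ≤ N.card * Fintype.card H + Fintype.card H := by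
  refine (Finset.card_union_le _ _).trans (add_le_add ?_ ?_)
  · exact Finset.card_image_le.trans (by simp)
  · exact Finset.card_image_le.trans ((Finset.card_filter_le _ _).trans (by simp))

/-- A bound for the number of degrees to be avoided by commutators of weight `n + 1`. -/
def shiftBound (q : ℕ) : ℕ → ℕ
  | 0 => q
  | n + 1 => shiftBound q n * q + q

/-- For `h ≠ 1` the map `a ↦ a - σ h a` is injective, so `z + σ h a = s + a` has at most one
solution, which `g` selects; for `h = 1` it would give `z = s`. The additional degree `0` is the
only possible solution of `s + σ h a = s + a`. -/
theorem exists_extension_degrees {σ : H → A ≃+ A} (hfix : ∀ h ≠ 1, ∀ a, σ h a = a → a = 0)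
    (hone : ∀ a, σ 1 a = a) {s : A} {N : Finset A} (hs : s ∉ N) :
    ∃ D : Finset A, D.card ≤ N.card * Fintype.card H + 1 ∧
      ∀ a ∉ D, s + a ∉ shiftedDegrees σ s N a := by
  classical
  let g : A × H → A := fun p =>
    if h : ∃ a, p.1 + σ p.2 a = s + a then h.choose else 0
  refine ⟨insert 0 ((N ×ˢ Finset.univ).image g), ?_, fun a ha hmem => ha ?_⟩
  · exact (Finset.card_insert_le _ _).trans
      (Nat.add_le_add_right (Finset.card_image_le.trans (by simp)) 1)
  rw [Finset.mem_insert, Finset.mem_image]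
  rcases mem_shiftedDegrees.1 hmem with ⟨z, hz, h, hza⟩ | ⟨h, h1, ha⟩
  · by_cases h1 : h = 1
    · rw [h1, hone, add_left_inj] at hza
      exact absurd (hza ▸ hz) hs
    · refine Or.inr ⟨(z, h), by simp [hz], ?_⟩
      have hex : ∃ a, z + σ h a = s + a := ⟨a, hza⟩
      have hch : z + σ h hex.choose = s + hex.choose := hex.choose_spec
      have hg : g (z, h) = hex.choose := dif_pos hex
      rw [hg, ← sub_eq_zero]
      refine hfix h h1 _ ?_
      rw [map_sub]
      calc σ h hex.choose - σ h a = (z + σ h hex.choose) - (z + σ h a) := by abel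
        _ = hex.choose - a := by rw [hch, hza]; abel
  · exact Or.inl (hfix h h1 a (add_left_cancel ha))

variable {ℒ : A → Submodule R L} {σ : H → A ≃+ A}

/-- The sum over the orbit of an element, as an element of the fixed-point subalgebra. -/
def orbitSum (H : Subgroup (L ≃ₗ⁅R⁆ L)) [Fintype H] (x : L) : fixedSubalgebra H :=
  ⟨∑ h : H, (h : L ≃ₗ⁅R⁆ L) x, fun g hg => by
    rw [map_sum]
    exact Fintype.sum_equiv (Equiv.mulLeft (⟨g, hg⟩ : H)) _ _ fun h => rfl⟩

theorem orbitSum_sub_self (x : L) :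
    (orbitSum H x : L) - x = ∑ h ∈ Finset.univ.filter (· ≠ (1 : H)), (h : L ≃ₗ⁅R⁆ L) x := by
  have h1 : (orbitSum H x : L) = ∑ h : H, (h : L ≃ₗ⁅R⁆ L) x := rfl
  rw [h1, Finset.filter_ne', ← Finset.add_sum_erase _ _ (Finset.mem_univ (1 : H))]
  exact add_sub_cancel_left x _

theorem isFixedApprox_zero (hσ : ∀ (h : H) (a : A), ∀ x ∈ ℒ a, (h : L ≃ₗ⁅R⁆ L) x ∈ ℒ (σ h a))
    {a : A} {x : L} (hx : x ∈ ℒ a) : IsFixedApprox ℒ H 0 a (shiftedDegrees σ 0 ∅ a) x := by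
  refine ⟨hx, orbitSum H x, by simp, ?_⟩
  rw [orbitSum_sub_self]
  refine sum_mem fun h hh => ?_
  have hmem : σ h a ∈ shiftedDegrees σ 0 ∅ a :=
    mem_shiftedDegrees.2 (Or.inr ⟨h, (Finset.mem_filter.1 hh).2, zero_add _⟩)
  exact Submodule.mem_iSup_of_mem _ (Submodule.mem_iSup_of_mem hmem (hσ h a x hx))

/-- With `X` the orbit sum, `⁅X, w⁆ - ⁅x, u⁆ = ⁅X, w - u⁆ + ⁅X - x, u⁆`. The first term shifts `N`
by the whole orbit of `a`, the second shifts `s` by the images of `a` under `h ≠ 1`. -/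
theorem IsFixedApprox.lie (hb : ∀ {a b : A} {x y : L}, x ∈ ℒ a → y ∈ ℒ b → ⁅x, y⁆ ∈ ℒ (a + b))
    (hσ : ∀ (h : H) (a : A), ∀ x ∈ ℒ a, (h : L ≃ₗ⁅R⁆ L) x ∈ ℒ (σ h a))
    {n : ℕ} {s : A} {N : Finset A} {u : L} (hu : IsFixedApprox ℒ H n s N u)
    {a : A} {x : L} (hx : x ∈ ℒ a) :
    IsFixedApprox ℒ H (n + 1) (s + a) (shiftedDegrees σ s N a) ⁅x, u⁆ := by
  obtain ⟨hus, w, hw, hwu⟩ := hu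
  refine ⟨add_comm a s ▸ hb hx hus, ⁅orbitSum H x, w⁆, ?_, ?_⟩
  · rw [LieModule.lowerCentralSeries_succ]
    exact LieSubmodule.lie_mem_lie (LieSubmodule.mem_top _) hw
  have hsplit : ((⁅orbitSum H x, w⁆ : fixedSubalgebra H) : L) - ⁅x, u⁆ =
      ⁅(orbitSum H x : L), (w : L) - u⁆ + ⁅(orbitSum H x : L) - x, u⁆ := by
    rw [LieSubalgebra.coe_bracket, lie_sub, sub_lie]
    abel
  rw [hsplit]
  refine add_mem ?_ ?_
  · have hle : ⨆ b ∈ N, ℒ b ≤ (⨆ b ∈ shiftedDegrees σ s N a, ℒ b).comap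
        (LieModule.toEnd R L L (orbitSum H x : L)) := by
      refine iSup₂_le fun b hbN y hy => ?_
      change ⁅∑ h : H, (h : L ≃ₗ⁅R⁆ L) x, y⁆ ∈ ⨆ b ∈ shiftedDegrees σ s N a, ℒ b
      rw [sum_lie]
      refine sum_mem fun h _ => ?_
      have hmem : σ h a + b ∈ shiftedDegrees σ s N a :=
        mem_shiftedDegrees.2 (Or.inl ⟨b, hbN, h, add_comm _ _⟩)
      exact Submodule.mem_iSup_of_mem _ (Submodule.mem_iSup_of_mem hmem (hb (hσ h a x hx) hy))
    exact hle hwu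
  · rw [orbitSum_sub_self, sum_lie]
    refine sum_mem fun h hh => ?_
    have hmem : σ h a + s ∈ shiftedDegrees σ s N a :=
      mem_shiftedDegrees.2 (Or.inr ⟨h, (Finset.mem_filter.1 hh).2, add_comm _ _⟩)
    exact Submodule.mem_iSup_of_mem _ (Submodule.mem_iSup_of_mem hmem (hb (hσ h a x hx) hus))

end FixedApproximation

/-! ### Long words of one degree -/

section Main

variable {A R L : Type*} [AddCommGroup A] [LinearOrder A] [IsOrderedAddMonoid A]
  [CommRing R] [LieRing L] [LieAlgebra R L] {ℒ : A → Submodule R L}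
  {H : Subgroup (L ≃ₗ⁅R⁆ L)} [Fintype H] [DecidableEq H] {σ : H → A ≃+ A}

/-- Degrees to be avoided by a commutator ending with letters of the same degree `e`: they involve
a nontrivial shift of the initial degree, or are small with respect to an order in which `e` is
greater than the other members of its orbit. -/
theorem exists_isFixedApprox_wordAct
    (hb : ∀ {a b : A} {x y : L}, x ∈ ℒ a → y ∈ ℒ b → ⁅x, y⁆ ∈ ℒ (a + b))
    (hσ : ∀ (h : H) (a : A), ∀ x ∈ ℒ a, (h : L ≃ₗ⁅R⁆ L) x ∈ ℒ (σ h a))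
    {e : A} {ψ : A ≃+ A} (hle : ∀ h, ψ (σ h e) ≤ ψ e) (hlt : ∀ h ≠ 1, ψ (σ h e) < ψ e)
    {a : A} {v : L} (hv : v ∈ ℒ a) (w : List (Σ a, ℒ a)) (hw : ∀ x ∈ w, x.1 = e) :
    ∃ N, IsFixedApprox ℒ H w.length (a + w.length • e) N (wordAct v w) ∧
      ∀ y ∈ N, (∃ h ≠ 1, ∃ t ∈ orbitSums σ e w.length, y = σ h a + t) ∨
        ψ y < ψ (a + w.length • e) := by
  induction w using List.reverseRecOn with
  | nil =>
    refine ⟨_, by simpa using isFixedApprox_zero hσ hv, fun y hy => Or.inl ?_⟩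
    rcases mem_shiftedDegrees.1 hy with ⟨z, hz, -⟩ | ⟨h, h1, rfl⟩
    · simp at hz
    · exact ⟨h, h1, 0, by simp [orbitSums], by simp⟩
  | append_singleton w x ih =>
    obtain ⟨N, hN, hNy⟩ := ih fun y hy => hw y (by simp [hy])
    have hx : x.1 = e := hw x (by simp)
    have hlen : a + (w ++ [x]).length • e = a + w.length • e + e := by
      rw [List.length_append, List.length_singleton, succ_nsmul, add_assoc]
    have hx2 : (x.2 : L) ∈ ℒ e := hx ▸ x.2.2
    have hstep := hN.lie hb hσ hx2
    refine ⟨shiftedDegrees σ (a + w.length • e) N e, ?_, ?_⟩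
    · rw [hlen, wordAct_append, List.length_append]
      exact hstep
    intro y hy
    rw [hlen]
    rcases mem_shiftedDegrees.1 hy with ⟨z, hz, h, rfl⟩ | ⟨h, h1, rfl⟩
    · rcases hNy z hz with ⟨g, hg, t, ht, rfl⟩ | hlt'
      · refine Or.inl ⟨g, hg, t + σ h e, ?_, add_assoc _ _ _⟩
        rw [List.length_append]
        exact Finset.mem_image.2 ⟨(t, h), by simp [ht], rfl⟩
      · refine Or.inr ?_
        rw [map_add, map_add _ _ e]
        exact add_lt_add_of_lt_of_le hlt' (hle h)
    · refine Or.inr ?_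
      rw [map_add, map_add _ _ e]
      exact add_lt_add_of_le_of_lt le_rfl (hlt h h1)

/-- Long words in a component of nonzero degree act as zero. -/
theorem wordAct_eq_zero_of_degree_ne_zero
    (hb : ∀ {a b : A} {x y : L}, x ∈ ℒ a → y ∈ ℒ b → ⁅x, y⁆ ∈ ℒ (a + b))
    (hind : iSupIndep ℒ) (htop : ⨆ a, ℒ a = ⊤)
    (hσ : ∀ (h : H) (a : A), ∀ x ∈ ℒ a, (h : L ≃ₗ⁅R⁆ L) x ∈ ℒ (σ h a))
    (hmul : ∀ (g h : H) (a : A), ℒ a ≠ ⊥ → σ (g * h) a = σ g (σ h a))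
    (hfix : ∀ h ≠ 1, ∀ a, σ h a = a → a = 0) {c : ℕ}
    (hc : IsNilpotentOfClass R (fixedSubalgebra H) c) {e : A} (he : e ≠ 0)
    (w : List (Σ a, ℒ a)) (hw : ∀ x ∈ w, x.1 = e)
    (hlen : Fintype.card H * Fintype.card H ^ c + c + 1 ≤ w.length) (v : L) :
    wordAct v w = 0 := by
  by_cases hbot : ℒ e = ⊥
  · obtain _ | ⟨x, w⟩ := w
    · simp at hlen
    · have hx : x.1 = e := hw x (by simp)
      have : (x.2 : L) = 0 := by
        rw [← Submodule.mem_bot R, ← hbot, ← hx]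
        exact x.2.2
      rw [wordAct_cons, this, zero_lie, wordAct_zero]
  have hv : v ∈ ⨆ a, ℒ a := htop ▸ Submodule.mem_top
  induction hv using Submodule.iSup_induction' with
  | zero => simp
  | add x y _ _ hx hy => rw [wordAct_add, hx, hy, add_zero]
  | mem s v hv =>
    -- Pulling the order back along `σ g` makes `e` the greatest element of its orbit.
    obtain ⟨g, hg⟩ := Finite.exists_max fun h : H => σ h e
    have hle : ∀ h, σ g (σ h e) ≤ σ g e := fun h => hmul g h e hbot ▸ hg (g * h)
    have hlt : ∀ h ≠ 1, σ g (σ h e) < σ g e := fun h h1 =>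
      (hle h).lt_of_ne fun heq => he (hfix h h1 e ((σ g).injective heq))
    -- If every `j` were bad, two of them would share `h` and `t`; subtracting gives `i • (e - σ h
    -- e) = j • (e - σ h e)` with `e ≠ σ h e`, contrary to torsion-freeness.
    obtain ⟨j, hj, hgood⟩ : ∃ j ∈ Finset.range (Fintype.card H * Fintype.card H ^ c + 1),
        ∀ h ≠ 1, ∀ t ∈ orbitSums σ e c, s + j • e + c • e ≠ σ h (s + j • e) + t := by
      by_contra! hbad
      choose! f hf1 F hF hEq using hbad
      obtain ⟨i, hi, j, hj, hij, heq⟩ := Finset.exists_ne_map_eq_of_card_lt_of_maps_to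
        (s := Finset.range (Fintype.card H * Fintype.card H ^ c + 1))
        (t := (Finset.univ : Finset H) ×ˢ orbitSums σ e c) (f := fun j => (f j, F j))
        (by
          rw [Finset.card_product, Finset.card_range, Finset.card_univ, Nat.lt_succ_iff]
          exact Nat.mul_le_mul_left _ (card_orbitSums_le σ e c))
        (fun j hj => by
          rw [Finset.mem_coe, Finset.mem_product]
          exact ⟨Finset.mem_univ _, hF j hj⟩)
      simp only [Prod.mk.injEq] at heq
      have h1 := hEq i hi
      have h2 := hEq j hj
      rw [heq.1, heq.2] at h1
      rw [map_add, map_nsmul] at h1 h2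
      have h3 : i • (e - σ (f j) e) = j • (e - σ (f j) e) := by
        rw [nsmul_sub, nsmul_sub]
        have h4 : i • e - i • σ (f j) e = (s + i • e + c • e) - i • σ (f j) e - s - c • e := by abel
        have h5 : j • e - j • σ (f j) e = (s + j • e + c • e) - j • σ (f j) e - s - c • e := by abel
        rw [h4, h5, h1, h2]
        abel
      have h6 : e - σ (f j) e ≠ 0 := fun h =>
        he (hfix (f j) (hf1 j hj) e (sub_eq_zero.1 h).symm)
      exact hij ((Nat.cast_injective (smul_left_injective ℤ h6 (by simpa only [natCast_zsmul] using h3))))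
    rw [Finset.mem_range] at hj
    have hsplit : w = w.take j ++ ((w.drop j).take c ++ (w.drop j).drop c) := by
      rw [List.take_append_drop, List.take_append_drop]
    have hl1 : (w.take j).length = j := List.length_take_of_le (by omega)
    have hl2 : ((w.drop j).take c).length = c :=
      List.length_take_of_le (by rw [List.length_drop]; omega)
    have hv' := wordAct_mem hb hv (w.take j) fun x hx => hw x (List.mem_of_mem_take hx)
    rw [hl1] at hv'
    obtain ⟨N, hN, hNy⟩ := exists_isFixedApprox_wordAct hb hσ hle hlt hv' ((w.drop j).take c)
      fun x hx => hw x (List.mem_of_mem_drop (List.mem_of_mem_take hx))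
    rw [hl2] at hN hNy
    rw [hsplit, wordAct_append]
    refine wordAct_append_eq_zero (hN.eq_zero hind hc fun hmem => ?_) _
    rcases hNy _ hmem with ⟨h, h1, t, ht, heq⟩ | hlt'
    · exact hgood h h1 t ht heq
    · exact lt_irrefl _ hlt'

/-! ### Assembling the bound -/

/-- The bound for the nilpotency class in terms of the order of `H`, the index of ad-nilpotency
of the zero component and the class of the fixed-point subalgebra. -/
def gradedClassBound (q k c : ℕ) : ℕ :=
  c * visitBound (max k (q * q ^ c + c + 1))
    (max k (q * q ^ c + c + 1) ^ (shiftBound q c * q + 1)) + k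

theorem shiftBound_mono (q : ℕ) (hq : 0 < q) : Monotone (shiftBound q) :=
  monotone_nat_of_le_succ fun _ =>
    (Nat.le_mul_of_pos_right _ hq).trans (Nat.le_add_right _ _)

/-- Downward induction on the weight: `i = c - n` extensions remain before `u` must vanish, and each
costs one application of `wordAct_eq_zero_of_length` in the quotient by the term already reached. -/
theorem IsFixedApprox.mem_ucs
    (hb : ∀ {a b : A} {x y : L}, x ∈ ℒ a → y ∈ ℒ b → ⁅x, y⁆ ∈ ℒ (a + b))
    (hind : iSupIndep ℒ) (htop : ⨆ a, ℒ a = ⊤)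
    (hσ : ∀ (h : H) (a : A), ∀ x ∈ ℒ a, (h : L ≃ₗ⁅R⁆ L) x ∈ ℒ (σ h a))
    (hone : ∀ a, σ 1 a = a) (hfix : ∀ h ≠ 1, ∀ a, σ h a = a → a = 0) {c M : ℕ} (hM0 : 0 < M)
    (hc : IsNilpotentOfClass R (fixedSubalgebra H) c)
    (hM : ∀ (e : A) (w : List (Σ a, ℒ a)) (v : L), (∀ x ∈ w, x.1 = e) → M ≤ w.length →
      wordAct v w = 0) (i : ℕ) :
    ∀ (n : ℕ) (s : A) (N : Finset A) (u : L), n + i = c → IsFixedApprox ℒ H n s N u →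
      N.card ≤ shiftBound (Fintype.card H) n → s ∉ N →
      u ∈ (⊥ : LieIdeal R L).ucs (i * visitBound M (M ^ (shiftBound (Fintype.card H) c *
        Fintype.card H + 1))) := by
  induction i with
  | zero =>
    intro n s N u hn hu _ hs
    rw [add_zero] at hn
    rw [hu.eq_zero hind (hn ▸ hc) hs]
    exact zero_mem _
  | succ i ih =>
    intro n s N u hn hu hN hs
    set B := visitBound M (M ^ (shiftBound (Fintype.card H) c * Fintype.card H + 1)) with hB
    set Z := (⊥ : LieIdeal R L).ucs (i * B) with hZ
    obtain ⟨D, hDc, hD⟩ := exists_extension_degrees hfix hone hs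
    rw [add_mul, one_mul, add_comm, LieSubmodule.ucs_add, ← hZ]
    refine mem_ucs_of_forall_words htop Z B u fun w hw => ?_
    refine (LieSubmodule.Quotient.mk_eq_zero Z).1 ((wordAct_mk Z u w).symm.trans ?_)
    refine wordAct_eq_zero_of_length hb _ D _ M (hDc.trans ?_) hM0 ?_ ?_ w hw.ge
    · refine Nat.add_le_add_right (Nat.mul_le_mul_right _ (hN.trans ?_)) 1
      exact shiftBound_mono _ Fintype.card_pos (by omega)
    · intro x hx
      have hmem := ih (n + 1) (s + x.1) (shiftedDegrees σ s N x.1) ⁅(x.2 : L), u⁆ (by omega)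
        (hu.lie hb hσ x.2.2)
        ((card_shiftedDegrees_le _ _ _ _).trans
          (Nat.add_le_add_right (Nat.mul_le_mul_right _ hN) _)) (hD _ hx)
      exact (LieSubmodule.Quotient.mk_eq_zero (N := Z)).2 hmem
    · intro e w v hw hl
      obtain ⟨v, rfl⟩ := LieSubmodule.Quotient.surjective_mk' Z v
      change wordAct (LieSubmodule.Quotient.mk v : L ⧸ Z) w = 0
      rw [wordAct_mk, hM e w v hw hl]
      rfl

theorem isNilpotentOfClass_of_graded
    (hb : ∀ {a b : A} {x y : L}, x ∈ ℒ a → y ∈ ℒ b → ⁅x, y⁆ ∈ ℒ (a + b))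
    (hind : iSupIndep ℒ) (htop : ⨆ a, ℒ a = ⊤)
    (hσ : ∀ (h : H) (a : A), ∀ x ∈ ℒ a, (h : L ≃ₗ⁅R⁆ L) x ∈ ℒ (σ h a))
    (hone : ∀ a, σ 1 a = a)
    (hmul : ∀ (g h : H) (a : A), ℒ a ≠ ⊥ → σ (g * h) a = σ g (σ h a))
    (hfix : ∀ h ≠ 1, ∀ a, σ h a = a → a = 0) {k c : ℕ} (hk : IsAdNilpotent (ℒ 0) k)
    (hc : IsNilpotentOfClass R (fixedSubalgebra H) c) :
    IsNilpotentOfClass R L (gradedClassBound (Fintype.card H) k c) := by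
  set M := max k (Fintype.card H * Fintype.card H ^ c + c + 1) with hMdef
  set B := visitBound M (M ^ (shiftBound (Fintype.card H) c * Fintype.card H + 1)) with hB
  have hM : ∀ (e : A) (w : List (Σ a, ℒ a)) (v : L), (∀ x ∈ w, x.1 = e) → M ≤ w.length →
      wordAct v w = 0 := by
    intro e w v hw hl
    by_cases he : e = 0
    · subst he
      have hz : wordAct v (w.take k) = 0 := by
        rw [wordAct_eq_zero_iff_foldl]
        refine hk v _ ?_ ?_
        · rw [List.length_map, List.length_take_of_le (by omega)]
        · intro y hy
          obtain ⟨x, hx, rfl⟩ := List.mem_map.1 hy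
          rw [← hw x (List.mem_of_mem_take hx)]
          exact x.2.2
      rw [← List.take_append_drop k w]
      exact wordAct_append_eq_zero hz _
    · exact wordAct_eq_zero_of_degree_ne_zero hb hind htop hσ hmul hfix hc he w hw (by omega) v
  have hne : ∀ (a : A) (x : L), x ∈ ℒ a → a ≠ 0 → x ∈ (⊥ : LieIdeal R L).ucs (c * B) := by
    intro a x hx ha
    refine IsFixedApprox.mem_ucs hb hind htop hσ hone hfix (by omega) hc hM c 0 a _ x (zero_add c)
      (isFixedApprox_zero hσ hx) ?_ fun hmem => ?_
    · simpa [shiftBound] using card_shiftedDegrees_le σ 0 ∅ a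
    · rcases mem_shiftedDegrees.1 hmem with ⟨z, hz, -⟩ | ⟨h, h1, hh⟩
      · simp at hz
      · exact ha (hfix h h1 a (by rwa [zero_add] at hh))
  have hmono : ∀ j, (⊥ : LieIdeal R L).ucs (c * B) ≤ (⊥ : LieIdeal R L).ucs (c * B + j) := by
    intro j
    rw [add_comm, LieSubmodule.ucs_add]
    generalize (⊥ : LieIdeal R L).ucs (c * B) = Z
    induction j with
    | zero => exact le_rfl
    | succ j ih => exact ih.trans (LieSubmodule.ucs_succ (N := Z) j ▸ LieSubmodule.le_normalizer _)
  -- A letter of nonzero degree takes an element of degree `0` into a component covered by `hne`;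
  -- only words of degree-`0` letters remain, which accounts for the summand `k`.
  have hzero : ∀ (j : ℕ) (u : L), u ∈ ℒ 0 →
      (∀ w : List (Σ a, ℒ a), (∀ x ∈ w, x.1 = 0) → w.length = j → wordAct u w = 0) →
      u ∈ (⊥ : LieIdeal R L).ucs (c * B + j) := by
    intro j
    induction j with
    | zero =>
      intro u _ hw
      have : u = 0 := hw [] (by simp) rfl
      rw [this]
      exact zero_mem _
    | succ j ih =>
      intro u hu hw
      refine mem_ucs_succ_of_homogeneous htop _ _ u fun a x hx => ?_
      by_cases ha : a = 0
      · subst ha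
        refine ih _ (by simpa using hb hx hu) fun w hw0 hl => ?_
        exact hw (⟨0, x, hx⟩ :: w) (by simpa using hw0) (by simp [hl])
      · exact hmono j (hne a _ (by simpa using hb hx hu) ha)
  rw [IsNilpotentOfClass, ← le_bot_iff, ← LieSubmodule.ucs_eq_top_iff, eq_top_iff]
  rintro v -
  have hv : v ∈ ⨆ a, ℒ a := htop ▸ Submodule.mem_top
  change v ∈ (⊥ : LieIdeal R L).ucs (c * B + k)
  induction hv using Submodule.iSup_induction' with
  | zero => exact zero_mem _
  | add x y _ _ hx hy => exact add_mem hx hy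
  | mem a x hx =>
    by_cases ha : a = 0
    · subst ha
      refine hzero k x hx fun w hw hl => ?_
      rw [wordAct_eq_zero_iff_foldl]
      refine hk x _ (by simpa using hl) fun y hy => ?_
      obtain ⟨z, hz, rfl⟩ := List.mem_map.1 hy
      rw [← hw z hz]
      exact z.2.2
    · exact hmono k (hne a x hx ha)

end Main

/-! ### Removing the choice of order and normalising the action -/

theorem theorem1p3 :
    ∃ f : ℕ → ℕ → ℕ → ℕ,
      ∀ {A R L : Type*} [AddCommGroup A] [IsAddTorsionFree A] [DecidableEq A]
        [CommRing R] [LieRing L] [LieAlgebra R L]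
        (ℒ : A → Submodule R L) [GradedLieAlgebra ℒ]
        (k c : ℕ)
        (H : Subgroup (L ≃ₗ⁅R⁆ L)) [Finite H]
        (σ : H → (A ≃+ A)),
        IsAdNilpotent (ℒ 0) k →
        (∀ h : H, IsDoubleAutomorphism ℒ (h : L ≃ₗ⁅R⁆ L) (σ h)) →
        (∀ h : H, h ≠ 1 → fixedDegrees (σ h) = ⊥) →
        IsNilpotentOfClass R (fixedSubalgebra H) c →
        IsNilpotentOfClass R L (f (Nat.card H) k c) := by
  classical
  refine ⟨gradedClassBound, fun {A R L} _ _ _ _ _ _ ℒ _ k c H _ σ hk hσ hfix hc => ?_⟩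
  have hind : iSupIndep ℒ := (DirectSum.Decomposition.isInternal ℒ).submodule_iSupIndep
  have htop : ⨆ a, ℒ a = ⊤ := (DirectSum.Decomposition.isInternal ℒ).submodule_iSup_eq_top
  have hb : ∀ {a b : A} {x y : L}, x ∈ ℒ a → y ∈ ℒ b → ⁅x, y⁆ ∈ ℒ (a + b) :=
    fun hx hy => SetLike.GradedBracket.bracket_mem hx hy
  obtain ⟨_, _⟩ := exists_linearOrder_isOrderedAddMonoid A
  have := Fintype.ofFinite H
  -- `σ 1` is arbitrary on degrees of zero components, and is replaced by the identity.
  let τ : H → A ≃+ A := fun h => if h = 1 then AddEquiv.refl A else σ h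
  have hτ1 : τ 1 = AddEquiv.refl A := if_pos rfl
  have hτ : ∀ (h : H) (a : A), ∀ x ∈ ℒ a, (h : L ≃ₗ⁅R⁆ L) x ∈ ℒ (τ h a) := by
    intro h a x hx
    by_cases h1 : h = 1
    · rw [h1, hτ1]
      exact hx
    · have : τ h = σ h := if_neg h1
      rw [this, ← hσ h a]
      exact ⟨x, hx, rfl⟩
  rw [Nat.card_eq_fintype_card]
  refine isNilpotentOfClass_of_graded hb hind htop hτ (fun a => by rw [hτ1]; rfl) ?_ ?_ hk hc
  · intro g h a ha
    -- The image of a nonzero `x` lies in the components of both degrees, which must therefore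
    -- agree.
    obtain ⟨x, hx, hx0⟩ := Submodule.exists_mem_ne_zero_of_ne_bot ha
    by_contra hne
    have h1 := hτ (g * h) a x hx
    have h2 := hτ g _ _ (hτ h a x hx)
    have h3 : ((g * h : H) : L ≃ₗ⁅R⁆ L) x = 0 :=
      Submodule.disjoint_def.1 (hind.pairwiseDisjoint hne) _ h1 h2
    exact hx0 ((map_eq_zero_iff _ (g * h : H).1.injective).1 h3)
  · intro h h1 a ha
    have hτh : τ h = σ h := if_neg h1
    have hmem : a ∈ fixedDegrees (σ h) := hτh ▸ ha
    rwa [hfix h h1, AddSubgroup.mem_bot] at hmem
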